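/- Let $\varphi=\frac{1+\sqrt5}{2}$. The golden L is the translation surface obtained from the L-shaped polygon $\bigl([0,\varphi]\times[0,1]\bigr)\cup\bigl([0,1]\times[0,\varphi]\bigr)$ by gluing opposite parallel edges by translations: $(x,0)\sim(x,\varphi)$ for $0\le x\le 1$, $(x,0)\sim(x,1)$ for $1\le x\le\varphi$, $(0,y)\sim(\varphi,y)$ for $0\le y\le 1$, and $(0,y)\sim(1,y)$ for $1\le y\le\varphi$. All vertices represent one point, the cone point. A nonzero vector $v$ is a periodic direction vector if some straight-line trajectory with velocity $v$ that never meets the cone point is periodic. A saddle connection is a straight-line path that starts and ends at the cone point and does not meet it in between; its displacement is a saddle connection vector. The long saddle connection vector in the direction $v$ is the longest saddle connection vector that is a positive multiple of $v$. Let $\Sigma=\{[x,y] : x>0,\ y\ge 0\}$ be the first quadrant, let $$\sigma_0=\begin{pmatrix}1&\varphi\\0&1\end{pmatrix},\quad \sigma_1=\begin{pmatrix}\varphi&\varphi\\1&\varphi\end{pmatrix},\quad \sigma_2=\begin{pmatrix}\varphi&1\\\varphi&\varphi\end{pmatrix},\quad \sigma_3=\begin{pmatrix}1&0\\\varphi&1\end{pmatrix},$$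 and let $\Sigma_i=\sigma_i\Sigma$ for $i=0,1,2,3$; these four sectors partition $\Sigma$. The itinerary of $v\in\Sigma$ is the infinite sequence $k_0,k_1,k_2,\dots$ defined by $v_0=v$, $v_i\in\Sigma_{k_i}$, $v_{i+1}=\sigma_{k_i}^{-1}v_i$. A tree word is a finite word in $\{0,1,2,3\}$, possibly empty, whose last letter is not $0$. (Note that $\sigma_0[1,0]=[1,0]$; the empty word stands for the vector $[1,0]$ itself.) **Theorem.** Let $v\in\Sigma$ be a periodic direction vector on the golden L. 1. There is a unique tree word $k_0k_1\cdots k_n$ such that $v=\ell_v\,\sigma_{k_0}\sigma_{k_1}\cdots\sigma_{k_n}[1,0]$ for some $\ell_v>0$. Moreover, the itinerary of $v$ is exactly $k_0,k_1,\dots,k_n,0,0,0,\dots$. 2. The long saddle connection vector in the direction $v$ exists and equals $\sigma_{k_0}\sigma_{k_1}\cdots\sigma_{k_n}[1,0]$. 3. This vector is of the form $[a+b\varphi,\,c+d\varphi]$ with nonnegative integers $a,b,c,d$. -/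

import Mathlib

noncomputable section

open scoped goldenRatio

namespace GoldenL

/-- The plane. -/
abbrev Vec : Type := Fin 2 → ℝ

/-- Euclidean length of a vector. -/
def len (w : Vec) : ℝ := √(w 0 ^ 2 + w 1 ^ 2)

/-- `w` has the same direction as `v`: it is a positive multiple of `v`. -/
def SameDirection (v w : Vec) : Prop := ∃ c : ℝ, 0 < c ∧ w = c • v

/-! ### The golden L as a translation surface -/

/-- The closed L-shaped polygon: the unit square `[0,1] × [0,1]` together with the rectangles
`[1,φ] × [0,1]` and `[0,1] × [1,φ]`, whose short sides have length `φ - 1 = 1/φ`. -/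
def polygon : Set Vec :=
  {p | 0 ≤ p 0 ∧ 0 ≤ p 1 ∧ ((p 0 ≤ φ ∧ p 1 ≤ 1) ∨ (p 0 ≤ 1 ∧ p 1 ≤ φ))}

/-- The gluing of opposite parallel edges of the polygon by translations: an edge on the bottom or
on the left is glued to the opposite edge on the top or on the right. -/
inductive Glue : polygon → polygon → Prop
  | bottomLeft (p q : polygon) : p.1 0 ≤ 1 → p.1 1 = 0 → q.1 0 = p.1 0 → q.1 1 = φ → Glue p q
  | bottomRight (p q : polygon) : 1 ≤ p.1 0 → p.1 1 = 0 → q.1 0 = p.1 0 → q.1 1 = 1 → Glue p q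
  | leftBottom (p q : polygon) : p.1 1 ≤ 1 → p.1 0 = 0 → q.1 1 = p.1 1 → q.1 0 = φ → Glue p q
  | leftTop (p q : polygon) : 1 ≤ p.1 1 → p.1 0 = 0 → q.1 1 = p.1 1 → q.1 0 = 1 → Glue p q

/-- The golden L surface: the quotient of the polygon by the equivalence relation generated by
the edge gluings. -/
def Surface : Type := Quot Glue

/-- The point of the surface represented by a point of the polygon. -/
def toSurface (p : polygon) : Surface := Quot.mk Glue p

theorem zero_mem_polygon : (0 : Vec) ∈ polygon := by
  refine ⟨le_rfl, le_rfl, Or.inl ⟨?_, ?_⟩⟩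
  · exact Real.goldenRatio_pos.le
  · exact zero_le_one

/-- The cone point (of angle `6π`), the only singularity of the surface; all the vertices of the
polygon, the marked points `(1,0)` and `(0,1)` included, represent it. -/
def conePoint : Surface := toSurface ⟨0, zero_mem_polygon⟩

/-- From time `t` on, the path `γ` moves for a while in a straight line with velocity `v`,
starting at some representative of `γ t` in the polygon. -/
def StraightAfter (γ : ℝ → Surface) (v : Vec) (t : ℝ) : Prop :=
  ∃ (p : Vec) (ε : ℝ), 0 < ε ∧ ∀ s : ℝ, 0 ≤ s → s < ε →
    ∃ h : p + s • v ∈ polygon, γ (t + s) = toSurface ⟨p + s • v, h⟩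

/-- For a while before time `t`, the path `γ` moves in a straight line with velocity `v`,
arriving at some representative of `γ t` in the polygon. -/
def StraightBefore (γ : ℝ → Surface) (v : Vec) (t : ℝ) : Prop :=
  ∃ (p : Vec) (ε : ℝ), 0 < ε ∧ ∀ s : ℝ, 0 ≤ s → s < ε →
    ∃ h : p - s • v ∈ polygon, γ (t - s) = toSurface ⟨p - s • v, h⟩

/-- `w` is the holonomy vector of a saddle connection: of a straight path with velocity `w`,
traversed in unit time, that starts and ends at the cone point and does not meet it in between. -/
def IsSaddleConnectionVector (w : Vec) : Prop :=
  w ≠ 0 ∧ ∃ γ : ℝ → Surface,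
    γ 0 = conePoint ∧ γ 1 = conePoint ∧
    (∀ t, 0 < t → t < 1 → γ t ≠ conePoint) ∧
    (∀ t, 0 ≤ t → t < 1 → StraightAfter γ w t) ∧
    (∀ t, 0 < t → t ≤ 1 → StraightBefore γ w t)

/-- `v` is a periodic direction: some straight trajectory with velocity `v` that never meets the
cone point is periodic. -/
def IsPeriodicDirection (v : Vec) : Prop :=
  v ≠ 0 ∧ ∃ γ : ℝ → Surface,
    (∃ T : ℝ, 0 < T ∧ Function.Periodic γ T) ∧
    (∀ t, γ t ≠ conePoint) ∧
    (∀ t, StraightAfter γ v t) ∧ (∀ t, StraightBefore γ v t)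

/-- `w` is the long saddle connection vector in the direction of `v`. -/
def IsLongSaddleConnectionVector (v w : Vec) : Prop :=
  IsSaddleConnectionVector w ∧ SameDirection v w ∧
    ∀ w' : Vec, IsSaddleConnectionVector w' → SameDirection v w' → len w' ≤ len w

/-! ### Sectors and the algorithm -/

/-- The first quadrant `Σ`, without the positive vertical axis. -/
def quadrant : Set Vec := {p | 0 < p 0 ∧ 0 ≤ p 1}

/-- The matrices `σ₀, σ₁, σ₂, σ₃`. -/
def sigma : Fin 4 → Matrix (Fin 2) (Fin 2) ℝ :=
  ![!![1, φ; 0, 1], !![φ, φ; 1, φ], !![φ, 1; φ, φ], !![1, 0; φ, 1]]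

/-- The sectors `Σᵢ = σᵢ Σ`. -/
def sector (i : Fin 4) : Set Vec := (fun p => (sigma i).mulVec p) '' quadrant

theorem mem_sector_iff (i : Fin 4) (p : Vec) :
    p ∈ sector i ↔
      ![0 ≤ p 1 ∧ φ * p 1 < p 0, p 0 ≤ φ * p 1 ∧ p 1 < p 0,
        p 0 ≤ p 1 ∧ p 1 < φ * p 0, 0 < p 0 ∧ φ * p 0 ≤ p 1] i := by
  have h0 := Real.goldenRatio_pos
  have h1 := Real.one_lt_goldenRatio
  have h2 := Real.goldenRatio_sq
  generalize hg : φ = g at h0 h1 h2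
  have h3 : g * g = g + 1 := by rw [← h2]; ring
  constructor
  · rintro ⟨q, ⟨hq0, hq1⟩, rfl⟩
    have hm := mul_nonneg h0.le hq1
    have hm0 := mul_pos h0 hq0
    fin_cases i <;>
      simp only [sigma, hg, Fin.zero_eta, Fin.mk_one, Fin.reduceFinMk, Matrix.cons_val,
        Matrix.mulVec, dotProduct, Fin.sum_univ_two, Matrix.of_apply] <;>
      constructor <;> nlinarith
  · intro h
    refine ⟨![![p 0 - g * p 1, p 1], ![g * p 0 - g * p 1, g * p 1 - p 0],
      ![g * p 0 - p 1, g * p 1 - g * p 0], ![p 0, p 1 - g * p 0]] i, ?_, ?_⟩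
    · fin_cases i <;>
        simp only [quadrant, Fin.zero_eta, Fin.mk_one, Fin.reduceFinMk, Matrix.cons_val] at h ⊢ <;>
        obtain ⟨ha, hb⟩ := h <;> constructor <;>
        simp only [Matrix.cons_val] <;> nlinarith
    · funext j
      fin_cases i <;> fin_cases j <;>
        simp only [sigma, hg, Fin.zero_eta, Fin.mk_one, Fin.reduceFinMk, Matrix.cons_val,
          Matrix.mulVec, dotProduct, Fin.sum_univ_two, Matrix.of_apply] <;>
        first | ring1 | linear_combination p 0 * h3 | linear_combination p 1 * h3

/-- `a` is the sequence of sectors `k₀, k₁, …` that the algorithm produces from `v`: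
`v₀ = v`, and `vᵢ₊₁ = σ_{kᵢ}⁻¹ vᵢ` where `vᵢ ∈ Σ_{kᵢ}`. -/
def IsItinerary (v : Vec) (a : ℕ → Fin 4) : Prop :=
  ∃ u : ℕ → Vec, u 0 = v ∧
    ∀ i, u i ∈ sector (a i) ∧ u (i + 1) = (sigma (a i))⁻¹.mulVec (u i)

/-- The vector `σ_{k₀} ⋯ σ_{kₙ} [1, 0]` of a word `k₀ ⋯ kₙ`; it is `[1, 0]` for the empty word. -/
def wordVector (k : List (Fin 4)) : Vec := (k.map sigma).prod.mulVec ![1, 0]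

/-- Tree words: the finite words, the empty one included, that do not end in `0`. (Since
`σ₀ [1, 0] = [1, 0]`, final zeros do not change the vector of a word.) -/
def IsTreeWord (k : List (Fin 4)) : Prop := k.getLast? ≠ some 0

end GoldenL

end

noncomputable section

open scoped goldenRatio

namespace GoldenL

/-! Each σᵢ and σᵢ⁻¹ is the derivative of an affine self-map of the surface that maps the cone
point, and no other point, to the cone point (`realizable_sigma`, `realizable_sigma_inv`). Such maps
carry trajectories to trajectories with the same time parameter, so the algorithm preserves the
period T of a periodic trajectory.

Existence of the word is a descent. If v has positive coordinates, the trajectory crosses edges only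
upwards or to the right, so T v has coordinates a + bφ, c + dφ with natural coefficients
(`HasPeriod.exists_holonomy`). As φ² = φ + 1, σᵢ acts on these coefficients by a nonnegative integer
matrix and increases their sum (`coefficient_sum_lt`). The sum thus drops at each inverse step, and
the algorithm must reach the horizontal direction (`exists_isTreeWord`).

The same maps reduce saddle connections in the direction of a word vector to horizontal ones, of
which the longest has length 1 (`horizontal_saddle_le`). Uniqueness holds because the sectors are
disjoint: v determines its itinerary, which is the word padded by zeros, and a tree word is
recovered from its padding (`IsTreeWord.ext`). -/

/-- Look at the infimum of the counterexamples. Straightness of a path is a local condition, and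
this induction turns it into statements about a whole time interval. -/
theorem real_induction {P : ℝ → Prop} {a b : ℝ} (h0 : P a)
    (hr : ∀ t, a ≤ t → t < b → P t → ∃ ε, 0 < ε ∧ ∀ s, 0 ≤ s → s < ε → P (t + s))
    (hl : ∀ t, a < t → t ≤ b → (∀ s, a ≤ s → s < t → P s) → P t) :
    ∀ t, a ≤ t → t ≤ b → P t := by
  by_contra! hcon
  obtain ⟨t₀, ha₀, hb₀, hP₀⟩ := hcon
  set B : Set ℝ := {t | a ≤ t ∧ t ≤ b ∧ ¬ P t} with hB
  have hne : B.Nonempty := ⟨t₀, ha₀, hb₀, hP₀⟩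
  have hbd : BddBelow B := ⟨a, fun t ht => ht.1⟩
  have ham : a ≤ sInf B := le_csInf hne fun t ht => ht.1
  have hmb : sInf B ≤ b := (csInf_le hbd ⟨ha₀, hb₀, hP₀⟩).trans hb₀
  have hlt : ∀ s, a ≤ s → s < sInf B → P s := by
    intro s hs hsm
    by_contra hPs
    exact absurd (csInf_le hbd ⟨hs, hsm.le.trans hmb, hPs⟩) (not_le.2 hsm)
  have hPm : P (sInf B) := by
    rcases ham.eq_or_lt with h | h
    · rwa [← h]
    · exact hl _ h hmb hlt
  have hmb' : sInf B < b := by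
    refine lt_of_le_of_ne hmb fun h => hP₀ ?_
    have : t₀ = sInf B := le_antisymm (hb₀.trans h.ge) (csInf_le hbd ⟨ha₀, hb₀, hP₀⟩)
    rwa [this]
  obtain ⟨ε, hε, hPε⟩ := hr _ ham hmb' hPm
  obtain ⟨t, ht, htε⟩ := exists_lt_of_csInf_lt hne (lt_add_of_pos_right (sInf B) hε)
  have := hPε (t - sInf B) (sub_nonneg.2 (csInf_le hbd ht)) (by linarith)
  rw [add_sub_cancel] at this
  exact ht.2.2 this

theorem goldenRatio_mul_self : φ * φ = φ + 1 := by
  rw [← Real.goldenRatio_sq]; ring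

theorem vec_eta (p : Vec) : p = ![p 0, p 1] := by
  funext j; fin_cases j <;> rfl

theorem vec_ext {p q : Vec} (h0 : p 0 = q 0) (h1 : p 1 = q 1) : p = q := by
  funext j; fin_cases j <;> assumption

theorem mk_mem_polygon {x y : ℝ} :
    ![x, y] ∈ polygon ↔ 0 ≤ x ∧ 0 ≤ y ∧ ((x ≤ φ ∧ y ≤ 1) ∨ (x ≤ 1 ∧ y ≤ φ)) := Iff.rfl

/-! ### Points of the surface and canonical representatives -/

open Classical in
/-- The point of the surface represented by `p`, with the cone point as a default value outside
the polygon. -/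
def pt (p : Vec) : Surface := if h : p ∈ polygon then toSurface ⟨p, h⟩ else conePoint

theorem pt_of_mem {p : Vec} (h : p ∈ polygon) : pt p = toSurface ⟨p, h⟩ := dif_pos h

theorem exists_pt (x : Surface) : ∃ p ∈ polygon, x = pt p := by
  induction x using Quot.ind with
  | mk p => exact ⟨p.1, p.2, (pt_of_mem p.2).symm⟩

theorem pt_zero : pt 0 = conePoint := pt_of_mem zero_mem_polygon

theorem pt_eq_of_glue {p q : Vec} (hp : p ∈ polygon) (hq : q ∈ polygon)
    (h : Glue ⟨p, hp⟩ ⟨q, hq⟩) : pt p = pt q := by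
  rw [pt_of_mem hp, pt_of_mem hq]
  exact Quot.sound h

theorem pt_bottomLeft {x : ℝ} (h0 : 0 ≤ x) (h1 : x ≤ 1) : pt ![x, φ] = pt ![x, 0] := by
  have := Real.one_lt_goldenRatio
  have hp : ![x, 0] ∈ polygon := ⟨h0, le_rfl, .inl ⟨h1.trans this.le, zero_le_one⟩⟩
  have hq : ![x, φ] ∈ polygon := ⟨h0, Real.goldenRatio_pos.le, .inr ⟨h1, le_rfl⟩⟩
  exact (pt_eq_of_glue hp hq (.bottomLeft _ _ h1 rfl rfl rfl)).symm

theorem pt_bottomRight {x : ℝ} (h0 : 1 ≤ x) (h1 : x ≤ φ) : pt ![x, 1] = pt ![x, 0] := by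
  have hx : 0 ≤ x := by linarith
  have hp : ![x, 0] ∈ polygon := ⟨hx, le_rfl, .inl ⟨h1, zero_le_one⟩⟩
  have hq : ![x, 1] ∈ polygon := ⟨hx, zero_le_one, .inl ⟨h1, le_rfl⟩⟩
  exact (pt_eq_of_glue hp hq (.bottomRight _ _ h0 rfl rfl rfl)).symm

theorem pt_leftBottom {y : ℝ} (h0 : 0 ≤ y) (h1 : y ≤ 1) : pt ![φ, y] = pt ![0, y] := by
  have := Real.one_lt_goldenRatio
  have hp : ![0, y] ∈ polygon := ⟨le_rfl, h0, .inr ⟨zero_le_one, h1.trans this.le⟩⟩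
  have hq : ![φ, y] ∈ polygon := ⟨Real.goldenRatio_pos.le, h0, .inl ⟨le_rfl, h1⟩⟩
  exact (pt_eq_of_glue hp hq (.leftBottom _ _ h1 rfl rfl rfl)).symm

theorem pt_leftTop {y : ℝ} (h0 : 1 ≤ y) (h1 : y ≤ φ) : pt ![1, y] = pt ![0, y] := by
  have hy : 0 ≤ y := by linarith
  have hp : ![0, y] ∈ polygon := ⟨le_rfl, hy, .inr ⟨zero_le_one, h1⟩⟩
  have hq : ![1, y] ∈ polygon := ⟨zero_le_one, hy, .inr ⟨le_rfl, h1⟩⟩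
  exact (pt_eq_of_glue hp hq (.leftTop _ _ h0 rfl rfl rfl)).symm

/-- Both coordinates are among `0, 1, φ`; in the polygon these are the vertices. -/
def IsVertex (p : Vec) : Prop :=
  (p 0 = 0 ∨ p 0 = 1 ∨ p 0 = φ) ∧ (p 1 = 0 ∨ p 1 = 1 ∨ p 1 = φ)

theorem pt_of_isVertex {p : Vec} (hp : p ∈ polygon) (hv : IsVertex p) : pt p = conePoint := by
  have h1 := Real.one_lt_goldenRatio
  have hz : pt ![0, 0] = conePoint := by
    rw [← pt_zero]; congr 1; exact vec_ext rfl rfl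
  have e1 := pt_bottomLeft le_rfl zero_le_one
  have e2 := pt_leftTop h1.le le_rfl
  have e3 := pt_bottomLeft zero_le_one le_rfl
  have e4 := pt_bottomRight le_rfl h1.le
  have e5 := pt_leftTop le_rfl h1.le
  have e6 := pt_leftBottom le_rfl zero_le_one
  have e7 := pt_leftBottom zero_le_one le_rfl
  rw [vec_eta p] at hp ⊢
  obtain ⟨h, h'⟩ := hv
  have hm := (mk_mem_polygon.1 hp).2.2
  rcases h with h | h | h <;> rcases h' with h' | h' | h' <;> rw [h, h'] at hm ⊢
  · exact hz
  · rw [← e5, e4, ← e3, e2, e1, hz]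
  · rw [e1, hz]
  · rw [← e3, e2, e1, hz]
  · rw [e4, ← e3, e2, e1, hz]
  · rw [e2, e1, hz]
  · rw [e6, hz]
  · rw [e7, ← e5, e4, ← e3, e2, e1, hz]
  · rcases hm with hm | hm <;> linarith [hm.1, hm.2]

open Classical in
/-- The representative of `p` that is not on the top or right edges; `0` for the vertices. -/
def canon (p : Vec) : Vec :=
  if IsVertex p then 0
  else if p 1 = φ ∨ (p 1 = 1 ∧ 1 < p 0) then ![p 0, 0]
  else if p 0 = φ ∨ (p 0 = 1 ∧ 1 < p 1) then ![0, p 1]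
  else p

-- This lets `canon` descend to the quotient, giving an invariant that tells points of the surface
-- apart without describing the generated equivalence relation.
open Classical in
theorem canon_eq_of_glue (p q : polygon) (h : Glue p q) : canon p.1 = canon q.1 := by
  have h1 := Real.one_lt_goldenRatio
  obtain ⟨p, hp0, hp1, hp⟩ := p
  obtain ⟨q, hq0, hq1, hq⟩ := q
  have hz : canon p = canon q ↔ canon p 0 = canon q 0 ∧ canon p 1 = canon q 1 :=
    ⟨fun h => h ▸ ⟨rfl, rfl⟩, fun h => vec_ext h.1 h.2⟩
  rw [hz]
  have hc0 : ∀ p, canon p 0 = if IsVertex p then 0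
      else if p 1 = φ ∨ (p 1 = 1 ∧ 1 < p 0) then p 0
      else if p 0 = φ ∨ (p 0 = 1 ∧ 1 < p 1) then 0 else p 0 := by
    intro p; unfold canon; split_ifs <;> rfl
  have hc1 : ∀ p, canon p 1 = if IsVertex p then 0
      else if p 1 = φ ∨ (p 1 = 1 ∧ 1 < p 0) then 0
      else if p 0 = φ ∨ (p 0 = 1 ∧ 1 < p 1) then p 1 else p 1 := by
    intro p; unfold canon; split_ifs <;> rfl
  simp only [hc0, hc1, IsVertex]
  clear hc0 hc1 hz
  rcases h with ⟨ha, hb, hc, hd⟩ | ⟨ha, hb, hc, hd⟩ | ⟨ha, hb, hc, hd⟩ | ⟨ha, hb, hc, hd⟩ <;>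
    simp only at ha hb hc hd <;> grind

theorem canon_congr {p q : Vec} (hp : p ∈ polygon) (hq : q ∈ polygon) (h : pt p = pt q) :
    canon p = canon q := by
  rw [pt_of_mem hp, pt_of_mem hq] at h
  exact congrArg (Quot.lift (fun p : polygon => canon p.1) canon_eq_of_glue) h

theorem canon_zero : canon 0 = 0 := if_pos ⟨.inl rfl, .inl rfl⟩

/-- A point of the polygon that is not a vertex has a nonzero canonical representative. -/
theorem pt_eq_conePoint_iff {p : Vec} (hp : p ∈ polygon) : pt p = conePoint ↔ IsVertex p := by
  refine ⟨fun h => ?_, pt_of_isVertex hp⟩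
  have h1 := Real.one_lt_goldenRatio
  rw [← pt_zero] at h
  have hc := canon_congr hp zero_mem_polygon h
  rw [canon_zero] at hc
  by_contra hv
  rw [canon, if_neg hv] at hc
  unfold IsVertex at hv
  split_ifs at hc with ha hb
  · have e := congrFun hc 0
    simp at e
    grind
  · have e := congrFun hc 1
    simp at e
    grind
  · have e := congrFun hc 0
    have e' := congrFun hc 1
    simp at e e'
    grind

/-! ### Affine self-maps of the surface -/

/-- `f` carries germs of straight paths with velocity `v` to germs with velocity `A v`. -/
def CarriesGerms (f : Surface → Surface) (A : Matrix (Fin 2) (Fin 2) ℝ) : Prop :=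
  ∀ (p v : Vec) (ε : ℝ), 0 < ε → (∀ s : ℝ, 0 ≤ s → s < ε → p + s • v ∈ polygon) →
    ∃ (p' : Vec) (ε' : ℝ), 0 < ε' ∧ ε' ≤ ε ∧ ∀ s : ℝ, 0 ≤ s → s < ε' →
      p' + s • A.mulVec v ∈ polygon ∧ f (pt (p + s • v)) = pt (p' + s • A.mulVec v)

/-- `A` is the derivative of an affine self-map of the golden L that fixes the cone point and
sends no other point to it. -/
def Realizable (A : Matrix (Fin 2) (Fin 2) ℝ) : Prop :=
  ∃ f : Surface → Surface, (∀ x, f x = conePoint ↔ x = conePoint) ∧ CarriesGerms f A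

theorem Realizable.mul {A B : Matrix (Fin 2) (Fin 2) ℝ} (hA : Realizable A) (hB : Realizable B) :
    Realizable (A * B) := by
  obtain ⟨f, hf, hfA⟩ := hA
  obtain ⟨g, hg, hgB⟩ := hB
  refine ⟨f ∘ g, fun x => (hf _).trans (hg x), fun p v ε hε h => ?_⟩
  obtain ⟨p₁, ε₁, hε₁, hle₁, h₁⟩ := hgB p v ε hε h
  obtain ⟨p₂, ε₂, hε₂, hle₂, h₂⟩ := hfA p₁ _ ε₁ hε₁ fun s hs hs' => (h₁ s hs hs').1
  refine ⟨p₂, ε₂, hε₂, hle₂.trans hle₁, fun s hs hs' => ?_⟩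
  rw [← Matrix.mulVec_mulVec, Function.comp_apply, (h₁ s hs (hs'.trans_le hle₂)).2]
  exact h₂ s hs hs'

theorem straightAfter_iff {γ : ℝ → Surface} {v : Vec} {t : ℝ} :
    StraightAfter γ v t ↔ ∃ (p : Vec) (ε : ℝ), 0 < ε ∧ ∀ s : ℝ, 0 ≤ s → s < ε →
      p + s • v ∈ polygon ∧ γ (t + s) = pt (p + s • v) := by
  unfold StraightAfter
  refine exists₂_congr fun p ε => and_congr_right fun _ => forall₃_congr fun s _ _ => ?_
  exact ⟨fun ⟨h, e⟩ => ⟨h, e.trans (pt_of_mem h).symm⟩, fun ⟨h, e⟩ => ⟨h, e.trans (pt_of_mem h)⟩⟩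

theorem straightBefore_iff {γ : ℝ → Surface} {v : Vec} {t : ℝ} :
    StraightBefore γ v t ↔ ∃ (p : Vec) (ε : ℝ), 0 < ε ∧ ∀ s : ℝ, 0 ≤ s → s < ε →
      p - s • v ∈ polygon ∧ γ (t - s) = pt (p - s • v) := by
  unfold StraightBefore
  refine exists₂_congr fun p ε => and_congr_right fun _ => forall₃_congr fun s _ _ => ?_
  exact ⟨fun ⟨h, e⟩ => ⟨h, e.trans (pt_of_mem h).symm⟩, fun ⟨h, e⟩ => ⟨h, e.trans (pt_of_mem h)⟩⟩

theorem StraightAfter.map {γ : ℝ → Surface} {v : Vec} {t : ℝ} (h : StraightAfter γ v t)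
    {f : Surface → Surface} {A : Matrix (Fin 2) (Fin 2) ℝ} (hf : CarriesGerms f A) :
    StraightAfter (f ∘ γ) (A.mulVec v) t := by
  rw [straightAfter_iff] at h ⊢
  obtain ⟨p, ε, hε, h⟩ := h
  obtain ⟨p', ε', hε', hle, h'⟩ := hf p v ε hε fun s hs hs' => (h s hs hs').1
  refine ⟨p', ε', hε', fun s hs hs' => ?_⟩
  rw [Function.comp_apply, (h s hs (hs'.trans_le hle)).2]
  exact h' s hs hs'

theorem StraightBefore.map {γ : ℝ → Surface} {v : Vec} {t : ℝ} (h : StraightBefore γ v t)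
    {f : Surface → Surface} {A : Matrix (Fin 2) (Fin 2) ℝ} (hf : CarriesGerms f A) :
    StraightBefore (f ∘ γ) (A.mulVec v) t := by
  have e : ∀ (s : ℝ) (p w : Vec), p - s • w = p + s • -w := fun s p w => by
    rw [smul_neg, sub_eq_add_neg]
  rw [straightBefore_iff] at h ⊢
  obtain ⟨p, ε, hε, h⟩ := h
  simp only [e] at h ⊢
  -- Read backwards, a germ arriving with velocity v is a germ leaving with velocity -v.
  obtain ⟨p', ε', hε', hle, h'⟩ := hf p (-v) ε hε fun s hs hs' => (h s hs hs').1
  rw [Matrix.mulVec_neg] at h'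
  refine ⟨p', ε', hε', fun s hs hs' => ?_⟩
  rw [Function.comp_apply, (h s hs (hs'.trans_le hle)).2]
  exact h' s hs hs'

/-- In `hgerm` one affine branch must serve a whole germ. It is compared with F only on the surface,
since on a boundary between pieces F may pick another representative. -/
theorem realizable_of_piecewise {A : Matrix (Fin 2) (Fin 2) ℝ} (F : Vec → Vec)
    (hF : ∀ p ∈ polygon, F p ∈ polygon)
    (hglue : ∀ p q : polygon, Glue p q → pt (F p.1) = pt (F q.1))
    (hvert : ∀ p ∈ polygon, IsVertex (F p) ↔ IsVertex p)
    (hgerm : ∀ (p v : Vec) (ε : ℝ), 0 < ε → (∀ s : ℝ, 0 ≤ s → s < ε → p + s • v ∈ polygon) →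
      ∃ (c : Vec) (ε' : ℝ), 0 < ε' ∧ ε' ≤ ε ∧ ∀ s : ℝ, 0 ≤ s → s < ε' →
        A.mulVec (p + s • v) + c ∈ polygon ∧
          pt (F (p + s • v)) = pt (A.mulVec (p + s • v) + c)) : Realizable A := by
  set f : Surface → Surface := Quot.lift (fun p : polygon => pt (F p.1)) hglue with hf
  have hfpt : ∀ p ∈ polygon, f (pt p) = pt (F p) := fun p hp => by rw [pt_of_mem hp]; rfl
  refine ⟨f, fun x => ?_, fun p v ε hε h => ?_⟩
  · obtain ⟨p, hp, rfl⟩ := exists_pt x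
    rw [hfpt p hp, pt_eq_conePoint_iff (hF p hp), pt_eq_conePoint_iff hp, hvert p hp]
  · obtain ⟨c, ε', hε', hle, h'⟩ := hgerm p v ε hε h
    refine ⟨A.mulVec p + c, ε', hε', hle, fun s hs hs' => ?_⟩
    have e : A.mulVec p + c + s • A.mulVec v = A.mulVec (p + s • v) + c := by
      rw [Matrix.mulVec_add, Matrix.mulVec_smul]; abel
    rw [e, hfpt _ (h s hs (hs'.trans_le hle))]
    exact h' s hs hs'

/-- An affine function does not change sign immediately to the right of 0, so a short germ stays on
one side of any line dividing two pieces. -/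
theorem affine_germ_sign (a b : ℝ) : ∃ ε, 0 < ε ∧
    ((∀ s, 0 ≤ s → s < ε → a + s * b ≤ 0) ∨
      ((∀ s, 0 < s → s < ε → 0 < a + s * b) ∧ ∀ s, 0 ≤ s → s < ε → 0 ≤ a + s * b)) := by
  rcases lt_trichotomy a 0 with ha | rfl | ha
  · refine ⟨-a / (|b| + 1), div_pos (neg_pos.2 ha) (by positivity), .inl fun s hs hs' => ?_⟩
    rw [lt_div_iff₀ (by positivity)] at hs'
    nlinarith [le_abs_self b, mul_le_mul_of_nonneg_left (le_abs_self b) hs]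
  · refine ⟨1, one_pos, ?_⟩
    rcases le_or_gt b 0 with hb | hb
    · exact .inl fun s hs _ => by nlinarith
    · exact .inr ⟨fun s hs _ => by nlinarith, fun s hs _ => by nlinarith⟩
  · have hpos : ∀ s, 0 ≤ s → s < a / (|b| + 1) → 0 < a + s * b := fun s hs hs' => by
      rw [lt_div_iff₀ (by positivity)] at hs'
      nlinarith [neg_abs_le b, mul_le_mul_of_nonneg_left (neg_abs_le b) hs]
    exact ⟨a / (|b| + 1), by positivity,
      .inr ⟨fun s hs hs' => hpos s hs.le hs', fun s hs hs' => (hpos s hs hs').le⟩⟩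

theorem germ_left_or_right {p v : Vec} {ε : ℝ} (hε : 0 < ε)
    (h : ∀ s : ℝ, 0 ≤ s → s < ε → p + s • v ∈ polygon) :
    ∃ ε', 0 < ε' ∧ ε' ≤ ε ∧ ((∀ s, 0 ≤ s → s < ε' → (p + s • v) 0 ≤ 1) ∨
      ∀ s, 0 ≤ s → s < ε' → 1 ≤ (p + s • v) 0 ∧ (p + s • v) 1 ≤ 1) := by
  obtain ⟨ε₁, hε₁, h₁⟩ := affine_germ_sign (p 0 - 1) (v 0)
  obtain ⟨ε₂, hε₂, h₂⟩ := affine_germ_sign (p 1 - 1) (v 1)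
  simp only [polygon, Set.mem_ofPred_eq, Pi.add_apply, Pi.smul_apply, smul_eq_mul] at h ⊢
  obtain ⟨ε', hε', hle, hle₁, hle₂⟩ : ∃ ε', 0 < ε' ∧ ε' ≤ ε ∧ ε' ≤ ε₁ ∧ ε' ≤ ε₂ :=
    ⟨min ε (min ε₁ ε₂), by positivity, by simp, by simp, by simp⟩
  refine ⟨ε', hε', hle, ?_⟩
  rcases h₁ with h₁ | ⟨h₁, h₁'⟩
  · exact .inl fun s hs hs' => by linarith [h₁ s hs (by linarith)]
  · rcases h₂ with h₂ | ⟨h₂, -⟩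
    · exact .inr fun s hs hs' =>
        ⟨by linarith [h₁' s hs (by linarith)], by linarith [h₂ s hs (by linarith)]⟩
    -- The germ would enter the corner missing from the L.
    · exfalso
      have a := h₁ (ε' / 2) (by linarith) (by linarith)
      have b := h₂ (ε' / 2) (by linarith) (by linarith)
      rcases (h (ε' / 2) (by linarith) (by linarith)).2.2 with c | c <;> linarith [c.1, c.2]

theorem germ_below_or_above {p v : Vec} {ε : ℝ} (hε : 0 < ε)
    (h : ∀ s : ℝ, 0 ≤ s → s < ε → p + s • v ∈ polygon) :
    ∃ ε', 0 < ε' ∧ ε' ≤ ε ∧ ((∀ s, 0 ≤ s → s < ε' → (p + s • v) 1 ≤ 1) ∨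
      ∀ s, 0 ≤ s → s < ε' → 1 ≤ (p + s • v) 1 ∧ (p + s • v) 0 ≤ 1) := by
  obtain ⟨ε', h1, h2, h3⟩ := germ_left_or_right (p := ![p 1, p 0]) (v := ![v 1, v 0]) hε
    fun s hs hs' => by
      obtain ⟨a, b, c⟩ := h s hs hs'
      exact ⟨b, a, c.symm.imp And.symm And.symm⟩
  exact ⟨ε', h1, h2, h3⟩

/-! ### Three generators: diagonal swap, reflection, shear -/

theorem realizable_swap : Realizable !![0, 1; 1, 0] := by
  have h1 := Real.one_lt_goldenRatio
  have hF : ∀ p ∈ polygon, ![p 1, p 0] ∈ polygon := fun p hp =>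
    ⟨hp.2.1, hp.1, hp.2.2.symm.imp And.symm And.symm⟩
  refine realizable_of_piecewise (fun p => ![p 1, p 0]) hF (fun p q h => ?_)
    (fun p _ => and_comm) (fun p v ε hε h => ⟨0, ε, hε, le_rfl, fun s hs hs' => ?_⟩)
  · refine pt_eq_of_glue (hF _ p.2) (hF _ q.2) ?_
    rcases h with ⟨ha, hb, hc, hd⟩ | ⟨ha, hb, hc, hd⟩ | ⟨ha, hb, hc, hd⟩ | ⟨ha, hb, hc, hd⟩
    · exact .leftBottom _ _ ha hb hc hd
    · exact .leftTop _ _ ha hb hc hd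
    · exact .bottomLeft _ _ ha hb hc hd
    · exact .bottomRight _ _ ha hb hc hd
  · have e : Matrix.mulVec !![0, 1; 1, 0] (p + s • v) + 0 = ![(p + s • v) 1, (p + s • v) 0] := by
      funext j; fin_cases j <;> simp [dotProduct]
    rw [e]
    exact ⟨hF _ (h s hs hs'), rfl⟩

-- Reflect each of the vertical strips over [0,1] and [1,φ] in its own midline. On the horizontal
-- circles of length φ and 1 this is x ↦ 1 - x, hence compatible with the side gluings.
open Classical in
theorem realizable_reflection : Realizable !![-1, 0; 0, 1] := by
  have h1 := Real.one_lt_goldenRatio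
  set F : Vec → Vec := fun p => if p 0 ≤ 1 then ![1 - p 0, p 1] else ![1 + φ - p 0, p 1] with hF
  have hA : ∀ (q : Vec) (c : ℝ),
      Matrix.mulVec !![-1, 0; 0, 1] q + ![c, 0] = ![c - q 0, q 1] := fun q c => by
    funext j; fin_cases j <;> (simp [dotProduct]; try ring)
  refine realizable_of_piecewise F (fun p hp => ?_) ?_ (fun p hp => ?_) fun p v ε hε h => ?_
  · obtain ⟨hp0, hp1, hp⟩ := hp
    simp only [hF]
    split_ifs <;> rw [mk_mem_polygon] <;> grind
  · rintro ⟨p, hp0, hp1, hp⟩ ⟨q, hq0, hq1, hq⟩ (⟨ha, hb, hc, hd⟩ | ⟨ha, hb, hc, hd⟩ |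
      ⟨ha, hb, hc, hd⟩ | ⟨ha, hb, hc, hd⟩) <;> simp only at ha hb hc hd <;>
      simp only [hF, hb, hc, hd]
    · rw [if_pos ha, if_pos ha, pt_bottomLeft (by linarith) (by linarith)]
    · split_ifs with h
      · have : p 0 = 1 := le_antisymm h ha
        rw [this, sub_self, ← pt_leftTop le_rfl h1.le, pt_bottomRight le_rfl h1.le,
          ← pt_bottomLeft zero_le_one le_rfl, pt_leftTop h1.le le_rfl,
          pt_bottomLeft le_rfl zero_le_one]
      · rw [pt_bottomRight]
        · grind
        · grind
    · rw [if_pos zero_le_one, if_neg h1.not_ge, add_sub_cancel_right, sub_zero]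
    · rw [if_pos zero_le_one, if_pos le_rfl, sub_self, sub_zero, pt_leftTop ha]
      grind
  · obtain ⟨hp0, hp1, hp⟩ := hp
    simp only [hF, IsVertex]
    split_ifs <;> simp only [Matrix.cons_val] <;> grind
  · obtain ⟨ε', hε', hle, h'⟩ := germ_left_or_right hε h
    rcases h' with h' | h'
    · refine ⟨![1, 0], ε', hε', hle, fun s hs hs' => ?_⟩
      have hq := h s hs (hs'.trans_le hle)
      have hq' := h' s hs hs'
      generalize p + s • v = q at *
      obtain ⟨hq0, hq1, hq⟩ := hq
      rw [hA, mk_mem_polygon]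
      refine ⟨by grind, ?_⟩
      simp only [hF, if_pos hq']
    · refine ⟨![1 + φ, 0], ε', hε', hle, fun s hs hs' => ?_⟩
      have hq := h s hs (hs'.trans_le hle)
      have hq' := h' s hs hs'
      generalize p + s • v = q at *
      obtain ⟨hq0, hq1, hq⟩ := hq
      rw [hA, mk_mem_polygon]
      refine ⟨by grind, ?_⟩
      simp only [hF]
      split_ifs with hc
      -- On the common line x = 1 the map F uses the left branch and lands on (0, y), while the
      -- right branch gives the glued point (φ, y).
      · have : q 0 = 1 := le_antisymm hc hq'.1
        rw [this, sub_self, add_sub_cancel_left, pt_leftBottom hq1 hq'.2]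
      · rfl

theorem pt_eq_of_isVertex {p q : Vec} (hp : p ∈ polygon) (hq : q ∈ polygon) (hp' : IsVertex p)
    (hq' : IsVertex q) : pt p = pt q :=
  (pt_of_isVertex hp hp').trans (pt_of_isVertex hq hq').symm

open Classical in
/-- The horizontal shear by a full twist in both horizontal cylinders. -/
def shear (p : Vec) : Vec :=
  if p 1 ≤ 1 then
    if p 0 + φ * p 1 ≤ φ then ![p 0 + φ * p 1, p 1] else ![p 0 + φ * p 1 - φ, p 1]
  else
    if p 0 + φ * (p 1 - 1) ≤ 1 then ![p 0 + φ * (p 1 - 1), p 1]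
    else ![p 0 + φ * (p 1 - 1) - 1, p 1]

theorem shear_mem_polygon {p : Vec} (hp : p ∈ polygon) : shear p ∈ polygon := by
  have h1 := Real.one_lt_goldenRatio
  have h2 := goldenRatio_mul_self
  obtain ⟨hp0, hp1, hp⟩ := hp
  have h3 : 0 ≤ φ * p 1 := by positivity
  unfold shear
  split_ifs with ha hb hb <;> rw [mk_mem_polygon]
  · exact ⟨by linarith, hp1, .inl ⟨hb, ha⟩⟩
  · have hx : p 0 ≤ φ := by rcases hp with h | h <;> linarith [h.1]
    exact ⟨by linarith, hp1, .inl ⟨by nlinarith, ha⟩⟩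
  · have hy : p 1 ≤ φ := by rcases hp with h | h <;> linarith [h.2]
    exact ⟨by nlinarith, hp1, .inr ⟨hb, hy⟩⟩
  · have hy : p 1 ≤ φ := by rcases hp with h | h <;> linarith [h.2]
    have hx : p 0 ≤ 1 := by rcases hp with h | h <;> linarith [h.1, h.2]
    exact ⟨by linarith, hp1, .inr ⟨by nlinarith, hy⟩⟩

theorem isVertex_shear {p : Vec} (hp : p ∈ polygon) : IsVertex (shear p) ↔ IsVertex p := by
  have h1 := Real.one_lt_goldenRatio
  have h2 := goldenRatio_mul_self
  obtain ⟨hp0, hp1, hp⟩ := hp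
  have h3 : (shear p) 1 = p 1 := by unfold shear; split_ifs <;> rfl
  unfold IsVertex
  rw [h3]
  refine and_congr_left fun hy => ?_
  -- With φ y known at the three vertex heights, the product becomes an atom and the remaining cases
  -- are linear.
  have hm : (p 1 = 0 ∧ φ * p 1 = 0) ∨ (p 1 = 1 ∧ φ * p 1 = φ) ∨
      (p 1 = φ ∧ φ * p 1 = φ + 1) := by
    rcases hy with e | e | e <;> rw [e] <;> simp [h2]
  unfold shear
  clear h3 hy
  simp only [mul_sub, mul_one]
  split_ifs with ha hb hb <;> simp only [Matrix.cons_val] <;>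
    generalize φ * p 1 = m at * <;> clear h2 <;> generalize φ = g at * <;> grind

theorem pt_shear_eq_of_glue (p q : polygon) (h : Glue p q) :
    pt (shear p.1) = pt (shear q.1) := by
  have h1 := Real.one_lt_goldenRatio
  have h2 := goldenRatio_mul_self
  have hps := shear_mem_polygon p.2
  have hqs := shear_mem_polygon q.2
  obtain ⟨p, hp0, hp1, hp⟩ := p
  obtain ⟨q, hq0, hq1, hq⟩ := q
  rcases h with ⟨ha, hb, hc, hd⟩ | ⟨ha, hb, hc, hd⟩ | ⟨ha, hb, hc, hd⟩ | ⟨ha, hb, hc, hd⟩ <;>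
    simp only at ha hb hc hd hps hqs ⊢
  · have ep : shear p = ![p 0, 0] := by
      rw [shear, hb, if_pos zero_le_one, if_pos (by linarith)]
      simp
    rcases hp0.eq_or_lt with h | h
    -- At vertices the shear can break the pairing: (0,0) stays put while (0,φ) goes to (1,φ). Both
    -- still represent the cone point.
    · refine pt_eq_of_isVertex hps hqs ?_ ?_ <;> rw [isVertex_shear]
      · exact ⟨.inl h.symm, .inl hb⟩
      · exact ⟨hp0, hp1, hp⟩
      · exact ⟨.inl (by rw [hc, h]), .inr (.inr hd)⟩
      · exact ⟨hq0, hq1, hq⟩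
    · have eq : shear q = ![p 0, φ] := by
        rw [shear, hc, hd, if_neg (by linarith), if_neg (by nlinarith)]
        congr 1
        linear_combination h2
      rw [ep, eq, pt_bottomLeft hp0 ha]
  · have ep : shear p = ![p 0, 0] := by
      rw [shear, hb, if_pos zero_le_one, if_pos (by grind)]
      simp
    have eq : shear q = ![p 0, 1] := by
      rw [shear, hc, hd, if_pos le_rfl, if_neg (by linarith)]
      simp
    rw [ep, eq, pt_bottomRight ha (by grind)]
  · rcases hp1.eq_or_lt with h | h
    · refine pt_eq_of_isVertex hps hqs ?_ ?_ <;> rw [isVertex_shear]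
      · exact ⟨.inl hb, .inl h.symm⟩
      · exact ⟨hp0, hp1, hp⟩
      · exact ⟨.inr (.inr hd), .inl (by rw [hc, h])⟩
      · exact ⟨hq0, hq1, hq⟩
    · have : 0 < φ * p 1 := by positivity
      have ep : shear p = ![φ * p 1, p 1] := by
        rw [shear, hb, if_pos ha, if_pos (by nlinarith)]
        simp
      have eq : shear q = ![φ * p 1, p 1] := by
        rw [shear, hc, hd, if_pos ha, if_neg (by linarith), add_sub_cancel_left]
      rw [ep, eq]
  · rcases ha.eq_or_lt with h | h
    · refine pt_eq_of_isVertex hps hqs ?_ ?_ <;> rw [isVertex_shear]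
      · exact ⟨.inl hb, .inr (.inl h.symm)⟩
      · exact ⟨hp0, hp1, hp⟩
      · exact ⟨.inr (.inl hd), .inr (.inl (by rw [hc, h]))⟩
      · exact ⟨hq0, hq1, hq⟩
    · have hpos : 0 < φ * (p 1 - 1) := mul_pos (by linarith) (by linarith)
      have hp2 : p 1 ≤ φ := by grind
      have ep : shear p = ![φ * (p 1 - 1), p 1] := by
        rw [shear, hb, if_neg h.not_ge, if_pos (by nlinarith), zero_add]
      have eq : shear q = ![φ * (p 1 - 1), p 1] := by
        rw [shear, hc, hd, if_neg h.not_ge, if_neg (by linarith), add_sub_cancel_left]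
      rw [ep, eq]

/-- The horizontal cylinders have circumferences φ and 1 and heights 1 and φ - 1 = 1/φ. The two
ratios of circumference to height both equal φ, so one shear twists each cylinder exactly once. -/
theorem realizable_shear : Realizable !![1, φ; 0, 1] := by
  have h1 := Real.one_lt_goldenRatio
  have h2 := goldenRatio_mul_self
  have hA : ∀ (q : Vec) (c : ℝ),
      Matrix.mulVec !![1, φ; 0, 1] q + ![c, 0] = ![q 0 + φ * q 1 + c, q 1] := fun q c => by
    funext j; fin_cases j <;> simp [dotProduct]
  refine realizable_of_piecewise shear (fun p => shear_mem_polygon) pt_shear_eq_of_glue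
    (fun p => isVertex_shear) fun p v ε hε h => ?_
  obtain ⟨ε₁, hε₁, hle₁, h₁⟩ := germ_below_or_above hε h
  rcases h₁ with h₁ | h₁
  · obtain ⟨ε₂, hε₂, h₂⟩ := affine_germ_sign (p 0 + φ * p 1 - φ) (v 0 + φ * v 1)
    have hm : 0 < min ε₁ ε₂ := lt_min hε₁ hε₂
    have e : ∀ s, p 0 + φ * p 1 - φ + s * (v 0 + φ * v 1) =
      (p + s • v) 0 + φ * (p + s • v) 1 - φ := fun s => by simp; ring
    simp only [e] at h₂
    rcases h₂ with h₂ | ⟨-, h₂⟩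
    · refine ⟨![0, 0], _, hm, (min_le_left _ _).trans hle₁, fun s hs hs' => ?_⟩
      have hq := h s hs (hs'.trans_le ((min_le_left _ _).trans hle₁))
      have hq₁ := h₁ s hs (hs'.trans_le (min_le_left _ _))
      have hq₂ := h₂ s hs (hs'.trans_le (min_le_right _ _))
      generalize p + s • v = q at *
      have eF : shear q = ![q 0 + φ * q 1 + 0, q 1] := by
        rw [shear, if_pos hq₁, if_pos (by linarith), add_zero]
      rw [hA, ← eF]
      exact ⟨shear_mem_polygon hq, rfl⟩
    · refine ⟨![-φ, 0], _, hm, (min_le_left _ _).trans hle₁, fun s hs hs' => ?_⟩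
      have hq := h s hs (hs'.trans_le ((min_le_left _ _).trans hle₁))
      have hq₁ := h₁ s hs (hs'.trans_le (min_le_left _ _))
      have hq₂ := h₂ s hs (hs'.trans_le (min_le_right _ _))
      generalize p + s • v = q at *
      rw [hA]
      by_cases hc : q 0 + φ * q 1 ≤ φ
      · have e0 : q 0 + φ * q 1 + -φ = 0 := by linarith
        have e1 : q 0 + φ * q 1 = φ := by linarith
        have eF : shear q = ![φ, q 1] := by rw [shear, if_pos hq₁, if_pos hc, e1]
        rw [e0, eF, pt_leftBottom hq.2.1 hq₁, mk_mem_polygon]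
        exact ⟨⟨le_rfl, hq.2.1, .inl ⟨by linarith, hq₁⟩⟩, rfl⟩
      · have eF : shear q = ![q 0 + φ * q 1 + -φ, q 1] := by
          rw [shear, if_pos hq₁, if_neg hc, sub_eq_add_neg]
        rw [← eF]
        exact ⟨shear_mem_polygon hq, rfl⟩
  · obtain ⟨ε₂, hε₂, h₂⟩ := affine_germ_sign (p 0 + φ * (p 1 - 1) - 1) (v 0 + φ * v 1)
    have hm : 0 < min ε₁ ε₂ := lt_min hε₁ hε₂
    have e : ∀ s, p 0 + φ * (p 1 - 1) - 1 + s * (v 0 + φ * v 1) =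
      (p + s • v) 0 + φ * ((p + s • v) 1 - 1) - 1 := fun s => by simp; ring
    simp only [e] at h₂
    rcases h₂ with h₂ | ⟨-, h₂⟩
    -- The upper cylinder is sheared relative to its base y = 1, which accounts for the translation
    -- by -φ; wrapping around subtracts a further 1.
    · refine ⟨![-φ, 0], _, hm, (min_le_left _ _).trans hle₁, fun s hs hs' => ?_⟩
      have hq := h s hs (hs'.trans_le ((min_le_left _ _).trans hle₁))
      obtain ⟨hq₁, hq₁'⟩ := h₁ s hs (hs'.trans_le (min_le_left _ _))
      have hq₂ := h₂ s hs (hs'.trans_le (min_le_right _ _))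
      generalize p + s • v = q at *
      have hq3 : q 1 ≤ φ := by rcases hq.2.2 with h | h <;> linarith [h.2]
      have hq0 := hq.1
      rw [hA]
      have hmem : ![q 0 + φ * q 1 + -φ, q 1] ∈ polygon :=
        mk_mem_polygon.2 ⟨by nlinarith, by linarith, .inr ⟨by linarith, hq3⟩⟩
      refine ⟨hmem, ?_⟩
      by_cases hc : q 1 ≤ 1
      · have hc1 : q 1 = 1 := le_antisymm hc hq₁
        rcases hq0.eq_or_lt with h0 | h0
        · refine pt_eq_of_isVertex (shear_mem_polygon hq) hmem
            ((isVertex_shear hq).2 ⟨.inl h0.symm, .inr (.inl hc1)⟩) ⟨.inl ?_, .inr (.inl hc1)⟩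
          rw [Matrix.cons_val_zero, hc1, ← h0]
          ring
        · rw [shear, if_pos hc, if_neg (by nlinarith), sub_eq_add_neg]
      · rw [shear, if_neg hc, if_pos (by linarith)]
        congr 2
        ring
    · refine ⟨![-φ - 1, 0], _, hm, (min_le_left _ _).trans hle₁, fun s hs hs' => ?_⟩
      have hq := h s hs (hs'.trans_le ((min_le_left _ _).trans hle₁))
      obtain ⟨hq₁, hq₁'⟩ := h₁ s hs (hs'.trans_le (min_le_left _ _))
      have hq₂ := h₂ s hs (hs'.trans_le (min_le_right _ _))
      generalize p + s • v = q at *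
      have hq3 : q 1 ≤ φ := by rcases hq.2.2 with h | h <;> linarith [h.2]
      have hq0 := hq.1
      rw [hA]
      have hmem : ![q 0 + φ * q 1 + (-φ - 1), q 1] ∈ polygon :=
        mk_mem_polygon.2 ⟨by linarith, by linarith, .inr ⟨by nlinarith, hq3⟩⟩
      refine ⟨hmem, ?_⟩
      by_cases hc : q 1 ≤ 1
      · have hc1 : q 1 = 1 := le_antisymm hc hq₁
        have hc0 : q 0 = 1 := by rw [hc1] at hq₂; linarith
        refine pt_eq_of_isVertex (shear_mem_polygon hq) hmem
          ((isVertex_shear hq).2 ⟨.inr (.inl hc0), .inr (.inl hc1)⟩) ⟨.inl ?_, .inr (.inl hc1)⟩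
        rw [Matrix.cons_val_zero, hc1, hc0]
        ring
      · by_cases hd : q 0 + φ * (q 1 - 1) ≤ 1
        · have e0 : q 0 + φ * q 1 + (-φ - 1) = 0 := by linarith
          have e1 : q 0 + φ * (q 1 - 1) = 1 := by linarith
          rw [shear, if_neg hc, if_pos hd, e0, e1, pt_leftTop hq₁ hq3]
        · rw [shear, if_neg hc, if_neg hd]
          congr 2
          ring

/-! ### The matrices σᵢ and their inverses are realizable -/

theorem sigma_inv (i : Fin 4) : (sigma i)⁻¹ =
    ![!![1, -φ; 0, 1], !![φ, -φ; -1, φ], !![φ, -1; -φ, φ], !![1, 0; -φ, 1]] i := by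
  have h2 := goldenRatio_mul_self
  refine Matrix.inv_eq_right_inv ?_
  fin_cases i <;> ext a b <;> fin_cases a <;> fin_cases b <;> simp [sigma, h2]

theorem sigma_inv_mulVec_sigma (i : Fin 4) (p : Vec) :
    (sigma i)⁻¹.mulVec ((sigma i).mulVec p) = p := by
  have h2 := goldenRatio_mul_self
  rw [sigma_inv, Matrix.mulVec_mulVec]
  have : (![!![1, -φ; 0, 1], !![φ, -φ; -1, φ], !![φ, -1; -φ, φ], !![1, 0; -φ, 1]] i :
      Matrix (Fin 2) (Fin 2) ℝ) * sigma i = 1 := by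
    fin_cases i <;> ext a b <;> fin_cases a <;> fin_cases b <;> simp [sigma, h2]
  rw [this, Matrix.one_mulVec]

/-- With T the shear, D the reflection and R the swap, σ₁ = T D R T, and conjugation by R exchanges
σ₀ with σ₃ and σ₁ with σ₂. -/
theorem realizable_sigma (i : Fin 4) : Realizable (sigma i) := by
  have h2 := goldenRatio_mul_self
  have hR := realizable_swap
  have hD := realizable_reflection
  have hT := realizable_shear
  have h1 : Realizable !![φ, φ; 1, φ] := by
    convert (hT.mul (hD.mul hR)).mul hT using 1
    ext a b; fin_cases a <;> fin_cases b <;> simp [h2]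
  fin_cases i
  · exact hT
  · exact h1
  · show Realizable !![φ, 1; φ, φ]
    convert (hR.mul h1).mul hR using 1
    ext a b; fin_cases a <;> fin_cases b <;> simp
  · show Realizable !![1, 0; φ, 1]
    convert (hR.mul hT).mul hR using 1
    ext a b; fin_cases a <;> fin_cases b <;> simp

/-- Since T⁻¹ = D T D, the inverses are again products of the generators, and no map of the surface
has to be inverted. -/
theorem realizable_sigma_inv (i : Fin 4) : Realizable (sigma i)⁻¹ := by
  have h2 := goldenRatio_mul_self
  have hR := realizable_swap
  have hD := realizable_reflection
  have hT : Realizable !![1, -φ; 0, 1] := by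
    convert (hD.mul realizable_shear).mul hD using 1
    ext a b; fin_cases a <;> fin_cases b <;> simp
  have h1 : Realizable !![φ, -φ; -1, φ] := by
    convert (hT.mul (hR.mul hD)).mul hT using 1
    ext a b; fin_cases a <;> fin_cases b <;> simp [h2]
  rw [sigma_inv]
  fin_cases i
  · exact hT
  · exact h1
  · show Realizable !![φ, -1; -φ, φ]
    convert (hR.mul h1).mul hR using 1
    ext a b; fin_cases a <;> fin_cases b <;> simp
  · show Realizable !![1, 0; -φ, 1]
    convert (hR.mul hT).mul hR using 1
    ext a b; fin_cases a <;> fin_cases b <;> simp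

/-! ### Holonomy of periodic trajectories -/

/-- Some straight trajectory with velocity `v` that never meets the cone point has period `T`. -/
def HasPeriod (v : Vec) (T : ℝ) : Prop :=
  ∃ γ : ℝ → Surface, Function.Periodic γ T ∧ (∀ t, γ t ≠ conePoint) ∧
    (∀ t, StraightAfter γ v t) ∧ (∀ t, StraightBefore γ v t)

theorem HasPeriod.map {v : Vec} {T : ℝ} (h : HasPeriod v T) {A : Matrix (Fin 2) (Fin 2) ℝ}
    (hA : Realizable A) : HasPeriod (A.mulVec v) T := by
  obtain ⟨γ, hper, hne, ha, hb⟩ := h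
  obtain ⟨f, hf, hfA⟩ := hA
  exact ⟨f ∘ γ, hper.comp f, fun t h => hne t ((hf _).1 h), fun t => (ha t).map hfA,
    fun t => (hb t).map hfA⟩

/-- The polygon without its top and right edges. -/
def lowerPolygon : Set Vec :=
  {p | 0 ≤ p 0 ∧ 0 ≤ p 1 ∧ ((p 0 < φ ∧ p 1 < 1) ∨ (p 0 < 1 ∧ p 1 < φ))}

theorem lowerPolygon_subset {p : Vec} (h : p ∈ lowerPolygon) : p ∈ polygon :=
  ⟨h.1, h.2.1, h.2.2.imp (And.imp le_of_lt le_of_lt) (And.imp le_of_lt le_of_lt)⟩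

theorem canon_of_mem_lowerPolygon {p : Vec} (h : p ∈ lowerPolygon) (hv : ¬ IsVertex p) :
    canon p = p := by
  have h1 := Real.one_lt_goldenRatio
  obtain ⟨hp0, hp1, hp⟩ := h
  rw [canon, if_neg hv, if_neg, if_neg] <;> grind

theorem eq_of_pt_eq {p q : Vec} (hp : p ∈ lowerPolygon) (hq : q ∈ lowerPolygon)
    (h : pt p = pt q) (hne : pt p ≠ conePoint) : p = q := by
  have hp' := lowerPolygon_subset hp
  have hq' := lowerPolygon_subset hq
  rw [← canon_of_mem_lowerPolygon hp (mt (pt_of_isVertex hp') hne),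
    ← canon_of_mem_lowerPolygon hq (mt (pt_of_isVertex hq') (h ▸ hne)), canon_congr hp' hq' h]

/-- Passing to the lower or left representative costs one gluing translation, by 1 or φ in one
coordinate: the contribution of one edge crossing to the holonomy. -/
theorem exists_lowerPolygon {p : Vec} (hp : p ∈ polygon) (hne : pt p ≠ conePoint) :
    ∃ q ∈ lowerPolygon, pt q = pt p ∧ ∃ a b c d : ℕ, q + ![a + b * φ, c + d * φ] = p := by
  have h1 := Real.one_lt_goldenRatio
  have hv := mt (pt_of_isVertex hp) hne
  obtain ⟨hp0, hp1, hp⟩ := hp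
  unfold IsVertex at hv
  by_cases ha : p 1 = φ
  · refine ⟨![p 0, 0], ⟨hp0, le_rfl, ?_⟩, ?_, 0, 0, 0, 1, vec_ext (by simp) (by simp [ha])⟩
    · simp only [Matrix.cons_val]; grind
    · rw [← pt_bottomLeft hp0 (by grind)]; exact congrArg pt (vec_ext rfl ha.symm)
  by_cases hb : p 1 = 1 ∧ 1 ≤ p 0
  · refine ⟨![p 0, 0], ⟨hp0, le_rfl, ?_⟩, ?_, 0, 0, 1, 0, vec_ext (by simp) (by simp [hb.1])⟩
    · simp only [Matrix.cons_val]; grind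
    · rw [← pt_bottomRight hb.2 (by grind)]; exact congrArg pt (vec_ext rfl hb.1.symm)
  by_cases hc : p 0 = φ
  · refine ⟨![0, p 1], ⟨le_rfl, hp1, ?_⟩, ?_, 0, 1, 0, 0, vec_ext (by simp [hc]) (by simp)⟩
    · simp only [Matrix.cons_val]; grind
    · rw [← pt_leftBottom hp1 (by grind)]; exact congrArg pt (vec_ext hc.symm rfl)
  by_cases hd : p 0 = 1 ∧ 1 ≤ p 1
  · refine ⟨![0, p 1], ⟨le_rfl, hp1, ?_⟩, ?_, 1, 0, 0, 0, vec_ext (by simp [hd.1]) (by simp)⟩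
    · simp only [Matrix.cons_val]; grind
    · rw [← pt_leftTop hd.2 (by grind)]; exact congrArg pt (vec_ext hd.1.symm rfl)
  refine ⟨p, ⟨hp0, hp1, by grind⟩, rfl, 0, 0, 0, 0, vec_ext (by simp) (by simp)⟩

/-- A point that can still move up and to the right inside the polygon is not on a top or right
edge. -/
theorem mem_lowerPolygon_of_add {p v : Vec} {s : ℝ} (hs : 0 < s) (hv0 : 0 < v 0) (hv1 : 0 < v 1)
    (hp0 : 0 ≤ p 0) (hp1 : 0 ≤ p 1) (h : p + s • v ∈ polygon) : p ∈ lowerPolygon := by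
  have h0 : 0 < s * v 0 := mul_pos hs hv0
  have h1 : 0 < s * v 1 := mul_pos hs hv1
  have h2 := h.2.2
  simp only [Pi.add_apply, Pi.smul_apply, smul_eq_mul] at h2
  refine ⟨hp0, hp1, h2.imp ?_ ?_⟩ <;> rintro ⟨ha, hb⟩ <;> constructor <;> linarith

/-- Unfold the trajectory in the plane: its position is the lower representative plus the
translations of the edges crossed so far. After one period the representative is back, leaving T v
as a sum of such translations. -/
theorem HasPeriod.exists_holonomy {v : Vec} {T : ℝ} (h : HasPeriod v T) (hT : 0 < T)
    (hv0 : 0 < v 0) (hv1 : 0 < v 1) :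
    ∃ a b c d : ℕ, T • v = ![a + b * φ, c + d * φ] := by
  obtain ⟨γ, hper, hne, hafter, hbefore⟩ := h
  simp only [straightAfter_iff, straightBefore_iff] at hafter hbefore
  have hstart : ∀ t, ∃ p ∈ lowerPolygon, ∃ ε, 0 < ε ∧ ∀ s, 0 ≤ s → s < ε →
      p + s • v ∈ lowerPolygon ∧ γ (t + s) = pt (p + s • v) := by
    intro t
    obtain ⟨p, ε, hε, h⟩ := hafter t
    have key : ∀ s, 0 ≤ s → s < ε → p + s • v ∈ lowerPolygon := fun s hs hs' => by
      obtain ⟨hm, -⟩ := h s hs hs'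
      obtain ⟨hm', -⟩ := h ((s + ε) / 2) (by linarith) (by linarith)
      refine mem_lowerPolygon_of_add (s := (ε - s) / 2) (by linarith) hv0 hv1 hm.1 hm.2.1 ?_
      convert hm' using 1
      rw [add_assoc, ← add_smul]; congr 2; ring
    refine ⟨p, by simpa using key 0 le_rfl hε, ε, hε, fun s hs hs' =>
      ⟨key s hs hs', (h s hs hs').2⟩⟩
  obtain ⟨p₀, hp₀, ε₀, hε₀, h₀⟩ := hstart 0
  have hp₀γ : γ 0 = pt p₀ := by simpa using (h₀ 0 le_rfl hε₀).2
  have key : ∀ t, 0 ≤ t → t ≤ T → ∃ p ∈ lowerPolygon, γ t = pt p ∧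
      ∃ a b c d : ℕ, p + ![a + b * φ, c + d * φ] = p₀ + t • v := by
    refine real_induction ⟨p₀, hp₀, hp₀γ, 0, 0, 0, 0, ?_⟩ ?_ ?_
    · exact vec_ext (by simp) (by simp)
    · rintro t - - ⟨p, hp, hpt, a, b, c, d, e⟩
      obtain ⟨p', hp', ε, hε, h'⟩ := hstart t
      have hpp : p = p' := by
        refine eq_of_pt_eq hp hp' ?_ (hpt ▸ hne t)
        rw [← hpt]
        simpa using (h' 0 le_rfl hε).2
      subst hpp
      refine ⟨ε, hε, fun s hs hs' => ⟨_, (h' s hs hs').1, (h' s hs hs').2, a, b, c, d, ?_⟩⟩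
      rw [add_right_comm, e, add_smul, add_assoc]
    -- Crossings are recorded here: the germ arriving at time t may end on a top or right edge,
    -- while just before t it is in the lower polygon.
    · rintro t ht - hprev
      obtain ⟨q, ε, hε, hq⟩ := hbefore t
      obtain ⟨hq0, hqt⟩ := hq 0 le_rfl hε
      rw [zero_smul, sub_zero, sub_zero] at hqt
      rw [zero_smul, sub_zero] at hq0
      obtain ⟨s, hs, hsε, hst⟩ : ∃ s, 0 < s ∧ s < ε ∧ s < t :=
        ⟨min ε t / 2, by positivity, by linarith [min_le_left ε t, lt_min hε ht],
          by linarith [min_le_right ε t, lt_min hε ht]⟩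
      obtain ⟨hqs, hqst⟩ := hq s hs.le hsε
      obtain ⟨p, hp, hpt, a, b, c, d, e⟩ := hprev (t - s) (by linarith) (by linarith)
      have hqs' : q - s • v ∈ lowerPolygon :=
        mem_lowerPolygon_of_add hs hv0 hv1 hqs.1 hqs.2.1 (by rwa [sub_add_cancel])
      have hpq : p = q - s • v :=
        eq_of_pt_eq hp hqs' (hpt.symm.trans hqst) (hpt ▸ hne _)
      obtain ⟨q', hq', hqq, a', b', c', d', e'⟩ := exists_lowerPolygon hq0 (hqt ▸ hne t)
      refine ⟨q', hq', hqt.trans hqq.symm, a + a', b + b', c + c', d + d', ?_⟩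
      have hfin : q' + ![a' + b' * φ, c' + d' * φ] + ![a + b * φ, c + d * φ] = p₀ + t • v := by
        rw [e', ← sub_add_cancel q (s • v), ← hpq, add_right_comm, e, sub_smul]
        abel
      rw [← hfin, add_assoc]
      congr 1
      exact vec_ext (by simp; ring) (by simp; ring)
  obtain ⟨p, hp, hpt, a, b, c, d, e⟩ := key T hT.le le_rfl
  have hγT : γ T = γ 0 := by simpa using hper 0
  have hpp : p = p₀ := eq_of_pt_eq hp hp₀ (hpt.symm.trans (hγT.trans hp₀γ)) (hpt ▸ hne T)
  rw [hpp] at e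
  exact ⟨a, b, c, d, (add_left_cancel e).symm⟩

/-! ### Descent on the holonomy coefficients -/

theorem natCast_add_mul_goldenRatio_inj {a b c d : ℕ} (h : (a : ℝ) + b * φ = c + d * φ) :
    a = c ∧ b = d := by
  have hb : b = d := by
    by_contra hne
    have hne' : (b : ℝ) - d ≠ 0 := sub_ne_zero.2 (by exact_mod_cast hne)
    refine Real.goldenRatio_irrational ⟨((c : ℚ) - a) / (b - d), ?_⟩
    push_cast
    rw [div_eq_iff hne']
    linarith
  subst hb
  exact ⟨by exact_mod_cast add_right_cancel h, rfl⟩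

theorem quadrant_subset_iUnion_sector {v : Vec} (hv : v ∈ quadrant) : ∃ i, v ∈ sector i := by
  obtain ⟨h0, h1⟩ := hv
  simp only [mem_sector_iff]
  rcases lt_or_ge (φ * v 1) (v 0) with ha | ha
  · exact ⟨0, h1, ha⟩
  rcases lt_or_ge (v 1) (v 0) with hb | hb
  · exact ⟨1, ha, hb⟩
  rcases lt_or_ge (v 1) (φ * v 0) with hc | hc
  · exact ⟨2, hb, hc⟩
  · exact ⟨3, h0, hc⟩

theorem wordVector_cons (i : Fin 4) (k : List (Fin 4)) :
    wordVector (i :: k) = (sigma i).mulVec (wordVector k) := by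
  simp only [wordVector, List.map_cons, List.prod_cons, Matrix.mulVec_mulVec]

theorem wordVector_nil : wordVector [] = ![1, 0] := by simp [wordVector]

theorem isTreeWord_cons {i : Fin 4} {k : List (Fin 4)} (hk : IsTreeWord k)
    (h : k = [] → i ≠ 0) : IsTreeWord (i :: k) := by
  unfold IsTreeWord at *
  cases k with
  | nil => simpa using h rfl
  | cons j l => rwa [List.getLast?_cons_cons]

/-- Irrationality of φ lets coefficients be compared. Positivity of both coordinates makes a' + b'
and c' + d' positive, which gives strictness even for the shears σ₀ and σ₃. -/
theorem coefficient_sum_lt (i : Fin 4) {w : Vec} {a b c d a' b' c' d' : ℕ}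
    (hw : w = ![a' + b' * φ, c' + d' * φ])
    (hσ : (sigma i).mulVec w = ![a + b * φ, c + d * φ]) (h0 : 0 < w 0) (h1 : 0 < w 1) :
    a' + b' + c' + d' < a + b + c + d := by
  have h2 := goldenRatio_mul_self
  rw [hw] at hσ h0 h1
  have hab : 0 < a' + b' := by
    by_contra! h
    obtain ⟨rfl, rfl⟩ : a' = 0 ∧ b' = 0 := by omega
    simp at h0
  have hcd : 0 < c' + d' := by
    by_contra! h
    obtain ⟨rfl, rfl⟩ : c' = 0 ∧ d' = 0 := by omega
    simp at h1
  have e0 := congrFun hσ 0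
  have e1 := congrFun hσ 1
  fin_cases i <;> simp [sigma] at e0 e1
  · have := natCast_add_mul_goldenRatio_inj (a := a' + d') (b := b' + c' + d')
      (c := a) (d := b) (by push_cast; linear_combination e0 - d' * h2)
    have := natCast_add_mul_goldenRatio_inj e1
    omega
  · have := natCast_add_mul_goldenRatio_inj (a := b' + d')
      (b := a' + c' + b' + d') (c := a) (d := b)
      (by push_cast; linear_combination e0 - (b' + d') * h2)
    have := natCast_add_mul_goldenRatio_inj (a := a' + d') (b := b' + c' + d')
      (c := c) (d := d) (by push_cast; linear_combination e1 - d' * h2)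
    omega
  · have := natCast_add_mul_goldenRatio_inj (a := c' + b') (b := d' + a' + b')
      (c := a) (d := b) (by push_cast; linear_combination e0 - b' * h2)
    have := natCast_add_mul_goldenRatio_inj (a := b' + d')
      (b := a' + c' + b' + d') (c := c) (d := d)
      (by push_cast; linear_combination e1 - (b' + d') * h2)
    omega
  · have := natCast_add_mul_goldenRatio_inj e0
    have := natCast_add_mul_goldenRatio_inj (a := c' + b') (b := d' + a' + b')
      (c := c) (d := d) (by push_cast; linear_combination e1 - b' * h2)
    omega

theorem exists_isTreeWord (T : ℝ) (hT : 0 < T) (N : ℕ) : ∀ (v : Vec) (a b c d : ℕ),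
    v ∈ quadrant → 0 < v 1 → HasPeriod v T → T • v = ![a + b * φ, c + d * φ] →
    a + b + c + d = N →
    ∃ k, IsTreeWord k ∧ ∃ ℓ : ℝ, 0 < ℓ ∧ v = ℓ • wordVector k := by
  induction N using Nat.strong_induction_on with
  | _ N ih =>
    intro v a b c d hv hv1 hper hhol hN
    obtain ⟨i, u, hu, hiu⟩ := quadrant_subset_iUnion_sector hv
    simp only at hiu
    have huper : HasPeriod u T := by
      have := hper.map (realizable_sigma_inv i)
      rwa [← hiu, sigma_inv_mulVec_sigma] at this
    rcases hu.2.eq_or_lt with h1 | h1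
    -- Here σᵢ⁻¹ v is horizontal and the descent stops. The last letter is not 0, because σ₀ fixes
    -- horizontal vectors and v is not horizontal.
    · refine ⟨[i], isTreeWord_cons (k := []) (by simp [IsTreeWord]) fun _ hi => ?_, u 0, hu.1, ?_⟩
      · subst hi
        rw [← hiu] at hv1
        simp [sigma, dotProduct, ← h1] at hv1
      · rw [wordVector_cons, wordVector_nil, ← hiu, ← Matrix.mulVec_smul]
        congr 1
        exact vec_ext (by simp) (by simp [← h1])
    · obtain ⟨a', b', c', d', hhol'⟩ := huper.exists_holonomy hT hu.1 h1
      have hlt : a' + b' + c' + d' < N :=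
        hN ▸ coefficient_sum_lt i hhol' (by rw [← hhol, ← hiu, Matrix.mulVec_smul])
          (mul_pos hT hu.1) (mul_pos hT h1)
      obtain ⟨k, hk, ℓ, hℓ, e⟩ := ih _ hlt u a' b' c' d' hu h1 huper hhol' rfl
      refine ⟨i :: k, isTreeWord_cons hk fun hnil _ => ?_, ℓ, hℓ, ?_⟩
      · rw [e, hnil, wordVector_nil] at h1
        simp at h1
      · rw [wordVector_cons, ← hiu, e, Matrix.mulVec_smul]

/-! ### Saddle connections -/

theorem IsSaddleConnectionVector.map {w : Vec} (h : IsSaddleConnectionVector w)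
    {A : Matrix (Fin 2) (Fin 2) ℝ} (hA : Realizable A) (hne : A.mulVec w ≠ 0) :
    IsSaddleConnectionVector (A.mulVec w) := by
  obtain ⟨-, γ, h0, h1, hcone, hafter, hbefore⟩ := h
  obtain ⟨f, hf, hfA⟩ := hA
  exact ⟨hne, f ∘ γ, (hf _).2 h0, (hf _).2 h1, fun t ht ht' h => hcone t ht ht' ((hf _).1 h),
    fun t ht ht' => (hafter t ht ht').map hfA, fun t ht ht' => (hbefore t ht ht').map hfA⟩

theorem isSaddleConnectionVector_sigma_mulVec (i : Fin 4) (w : Vec) :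
    IsSaddleConnectionVector ((sigma i).mulVec w) ↔ IsSaddleConnectionVector w := by
  constructor <;> intro h
  · have := h.map (realizable_sigma_inv i) fun h0 => h.1 ?_
    · rwa [sigma_inv_mulVec_sigma] at this
    · rw [sigma_inv_mulVec_sigma] at h0
      rw [h0, Matrix.mulVec_zero]
  · refine h.map (realizable_sigma i) fun h0 => h.1 ?_
    rw [← sigma_inv_mulVec_sigma i w, h0, Matrix.mulVec_zero]

theorem isSaddleConnectionVector_smul_wordVector (c : ℝ) (k : List (Fin 4)) :
    IsSaddleConnectionVector (c • wordVector k) ↔ IsSaddleConnectionVector (c • ![1, 0]) := by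
  induction k with
  | nil => rw [wordVector_nil]
  | cons i k ih => rw [wordVector_cons, ← Matrix.mulVec_smul,
      isSaddleConnectionVector_sigma_mulVec, ih]

theorem not_isVertex_bottom {x : ℝ} (h0 : 0 < x) (h1 : x < 1) (y : ℝ) : ¬ IsVertex ![x, y] := by
  have := Real.one_lt_goldenRatio
  rintro ⟨h | h | h, -⟩ <;> rw [Matrix.cons_val_zero] at h <;> linarith

theorem isSaddleConnectionVector_one_zero : IsSaddleConnectionVector ![1, 0] := by
  have h1 := Real.one_lt_goldenRatio
  have hmem : ∀ t : ℝ, 0 ≤ t → t ≤ 1 → ![t, 0] ∈ polygon := fun t h0 ht =>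
    ⟨h0, le_rfl, .inl ⟨ht.trans h1.le, zero_le_one⟩⟩
  refine ⟨fun h => one_ne_zero (congrFun h 0), fun t => pt ![t, 0], ?_, ?_, fun t ht ht' h => ?_,
    fun t ht ht' => straightAfter_iff.2 ⟨![t, 0], 1 - t, by linarith, fun s hs hs' => ?_⟩,
    fun t ht ht' => straightBefore_iff.2 ⟨![t, 0], t, ht, fun s hs hs' => ?_⟩⟩
  · exact pt_of_isVertex (hmem 0 le_rfl zero_le_one) ⟨.inl rfl, .inl rfl⟩
  · exact pt_of_isVertex (hmem 1 zero_le_one le_rfl) ⟨.inr (.inl rfl), .inl rfl⟩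
  · exact not_isVertex_bottom ht ht' 0 ((pt_eq_conePoint_iff (hmem t ht.le ht'.le)).1 h)
  · have e : ![t, 0] + s • ![1, 0] = ![t + s, 0] := vec_ext (by simp) (by simp)
    rw [e]
    exact ⟨hmem _ (by linarith) (by linarith), rfl⟩
  · have e : ![t, 0] - s • ![1, 0] = ![t - s, 0] := vec_ext (by simp) (by simp)
    rw [e]
    exact ⟨hmem _ (by linarith) (by linarith), rfl⟩

/-- A germ may run along a top edge instead of its glued bottom edge; moving right by r leads to the
same surface point. As x > 0, no left-right gluing interferes. -/
theorem pt_horizontal_translate {q : Vec} {x y r : ℝ} (hx : 0 < x) (hr : 0 ≤ r)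
    (hp : ![x, y] ∈ lowerPolygon) (hq : q ∈ polygon) (h : pt q = pt ![x, y])
    (hne : pt q ≠ conePoint) (hqr : ![q 0 + r, q 1] ∈ polygon) :
    pt ![q 0 + r, q 1] = pt ![x + r, y] := by
  have h1 := Real.one_lt_goldenRatio
  have hc := canon_congr hq (lowerPolygon_subset hp) h
  rw [canon_of_mem_lowerPolygon hp (mt (pt_of_isVertex (lowerPolygon_subset hp)) (h ▸ hne)),
    canon, if_neg (mt (pt_of_isVertex hq) hne)] at hc
  obtain ⟨-, -, hqr⟩ := mk_mem_polygon.1 hqr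
  split_ifs at hc with ha hb
  · have e0 : q 0 = x := congrFun hc 0
    have e1 : 0 = y := congrFun hc 1
    rw [e0] at hqr ha ⊢
    rw [← e1]
    rcases ha with ha | ha
    · rw [ha] at hqr ⊢
      exact pt_bottomLeft (by linarith) (by grind)
    · rw [ha.1] at hqr ⊢
      exact pt_bottomRight (by linarith) (by grind)
  · exact absurd (congrFun hc 0) hx.ne
  · rw [hc]; rfl

/-- Three rightward horizontal rays leave the cone point, represented at (0,0), (1,0) and (0,1).
They return to it after lengths 1, φ - 1 and 1, so a path with c > 1 would meet it at the time L / c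
< 1. -/
theorem horizontal_saddle_le {c : ℝ} (hc : 0 < c)
    (h : IsSaddleConnectionVector (c • ![1, 0])) : c ≤ 1 := by
  by_contra! hc1
  have h1 := Real.one_lt_goldenRatio
  have h2 := Real.goldenRatio_lt_two
  obtain ⟨-, γ, hγ0, -, hcone, hafter, hbefore⟩ := h
  have hadd : ∀ (q : Vec) (s : ℝ), q + s • c • ![1, 0] = ![q 0 + s * c, q 1] := fun q s =>
    vec_ext (by simp) (by simp)
  have hsub : ∀ (q : Vec) (s : ℝ), q - s • c • ![1, 0] = ![q 0 - s * c, q 1] := fun q s =>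
    vec_ext (by simp) (by simp)
  simp only [straightAfter_iff, straightBefore_iff, hadd, hsub] at hafter hbefore
  obtain ⟨x, y, L, hxyL, ε, hε, hstart⟩ : ∃ x y L : ℝ,
      ((x = 0 ∧ y = 0 ∧ L = 1) ∨ (x = 1 ∧ y = 0 ∧ L = φ - 1) ∨ (x = 0 ∧ y = 1 ∧ L = 1)) ∧
      ∃ ε, 0 < ε ∧ ∀ s, 0 ≤ s → s < ε → γ s = pt ![x + s * c, y] := by
    obtain ⟨p, ε, hε, h⟩ := hafter 0 le_rfl one_pos
    simp only [zero_add] at h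
    have hp : p ∈ polygon := by
      have := (h 0 le_rfl hε).1
      rwa [zero_mul, add_zero, ← vec_eta p] at this
    have hv : IsVertex p := by
      rw [← pt_eq_conePoint_iff hp, ← hγ0, (h 0 le_rfl hε).2, zero_mul, add_zero, ← vec_eta p]
    have hlt := (mk_mem_polygon.1 (h (ε / 2) (by linarith) (by linarith)).1).2.2
    have hpos : 0 < ε / 2 * c := by positivity
    have hpos' : ∀ s, 0 ≤ s → 0 ≤ s * c := fun s hs => mul_nonneg hs hc.le
    have hle := fun s hs hs' => (mk_mem_polygon.1 (h s hs hs').1).2.2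
    obtain ⟨e | e | e, e' | e' | e'⟩ := hv <;> simp only [e, e'] at h hlt hle
    · exact ⟨0, 0, 1, .inl ⟨rfl, rfl, rfl⟩, ε, hε, fun s hs hs' => (h s hs hs').2⟩
    · exact ⟨0, 1, 1, .inr (.inr ⟨rfl, rfl, rfl⟩), ε, hε, fun s hs hs' => (h s hs hs').2⟩
    · refine ⟨0, 0, 1, .inl ⟨rfl, rfl, rfl⟩, ε, hε, fun s hs hs' => ?_⟩
      have := hpos' s hs
      rw [(h s hs hs').2, pt_bottomLeft (by linarith) (by grind)]
    · exact ⟨1, 0, φ - 1, .inr (.inl ⟨rfl, rfl, rfl⟩), ε, hε, fun s hs hs' => (h s hs hs').2⟩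
    · refine ⟨1, 0, φ - 1, .inr (.inl ⟨rfl, rfl, rfl⟩), ε, hε, fun s hs hs' => ?_⟩
      have := hpos' s hs
      rw [(h s hs hs').2, pt_bottomRight (by linarith) (by grind)]
    -- From the remaining vertices a rightward step leaves the polygon, or the vertex is outside it
    -- already.
    all_goals exfalso; rcases hlt with a | a <;> linarith [a.1, a.2]
  have hL : 0 < L ∧ L ≤ 1 := by grind
  have hx : 0 ≤ x := by grind
  have hlow : ∀ r, 0 ≤ r → r < L → ![x + r, y] ∈ lowerPolygon := fun r hr hr' => by
    refine ⟨?_, ?_, ?_⟩ <;> simp only [Matrix.cons_val] <;> grind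
  have hb1 : L / c < 1 := (div_lt_one hc).2 (by linarith)
  have hb0 : 0 < L / c := div_pos hL.1 hc
  have key : ∀ t, 0 ≤ t → t ≤ L / c → γ t = pt ![x + t * c, y] := by
    refine real_induction (hstart 0 le_rfl hε) (fun t ht htb hPt => ?_) fun t ht htb hprev => ?_
    · rcases ht.eq_or_lt with rfl | ht'
      · exact ⟨ε, hε, fun s hs hs' => by rw [zero_add]; exact hstart s hs hs'⟩
      · obtain ⟨q, δ, hδ, hq⟩ := hafter t ht (by linarith)
        have hq0 := hq 0 le_rfl hδ
        rw [zero_mul, add_zero, add_zero, ← vec_eta] at hq0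
        refine ⟨δ, hδ, fun s hs hs' => ?_⟩
        rw [(hq s hs hs').2, add_mul, ← add_assoc]
        have htc : 0 < t * c := mul_pos ht' hc
        exact pt_horizontal_translate (by linarith) (mul_nonneg hs hc.le)
          (hlow _ htc.le ((lt_div_iff₀ hc).1 htb)) hq0.1 (hq0.2.symm.trans hPt)
          (hq0.2 ▸ hcone t ht' (by linarith)) (hq s hs hs').1
    · obtain ⟨q, δ, hδ, hq⟩ := hbefore t ht (by linarith)
      have hq0 := hq 0 le_rfl hδ
      rw [zero_mul, sub_zero, sub_zero, ← vec_eta] at hq0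
      obtain ⟨s, hs, hsδ, hst⟩ : ∃ s, 0 < s ∧ s < δ ∧ s < t :=
        ⟨min δ t / 2, by positivity, by linarith [min_le_left δ t, lt_min hδ ht],
          by linarith [min_le_right δ t, lt_min hδ ht]⟩
      have hqs := hq s hs.le hsδ
      have htc : 0 < (t - s) * c := mul_pos (by linarith) hc
      have htc' : (t - s) * c < L := (lt_div_iff₀ hc).1 (by linarith)
      have := pt_horizontal_translate (r := s * c) (by linarith) (mul_nonneg hs.le hc.le)
        (hlow _ htc.le htc') hqs.1 (hqs.2.symm.trans (hprev (t - s) (by linarith) (by linarith)))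
        (hqs.2 ▸ hcone _ (by linarith) (by linarith)) (by
          change ![q 0 - s * c + s * c, q 1] ∈ polygon
          rw [sub_add_cancel, ← vec_eta]
          exact hq0.1)
      change pt ![q 0 - s * c + s * c, q 1] = _ at this
      rw [sub_add_cancel, ← vec_eta, ← hq0.2] at this
      rw [this]
      congr 2
      ring
  refine hcone (L / c) hb0 hb1 ?_
  rw [key _ hb0.le le_rfl, div_mul_cancel₀ _ hc.ne']
  refine pt_of_isVertex (mk_mem_polygon.2 ?_) ?_
  · grind
  · simp only [IsVertex, Matrix.cons_val]; grind

theorem sigma_mulVec_mem_quadrant (i : Fin 4) {p : Vec} (hp : p ∈ quadrant) :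
    (sigma i).mulVec p ∈ quadrant := by
  have h0 := Real.goldenRatio_pos
  obtain ⟨hp0, hp1⟩ := hp
  fin_cases i <;> constructor <;> simp [sigma] <;> positivity

theorem wordVector_mem_quadrant (k : List (Fin 4)) : wordVector k ∈ quadrant := by
  induction k with
  | nil => rw [wordVector_nil]; exact ⟨one_pos, le_rfl⟩
  | cons i k ih => rw [wordVector_cons]; exact sigma_mulVec_mem_quadrant i ih

theorem len_smul {c : ℝ} (hc : 0 ≤ c) (w : Vec) : len (c • w) = c * len w := by
  rw [len, len, ← Real.sqrt_sq hc, ← Real.sqrt_mul (sq_nonneg c), Real.sqrt_sq hc]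
  congr 1
  simp
  ring

theorem isLongSaddleConnectionVector_iff {v w : Vec} {k : List (Fin 4)} {ℓ : ℝ} (hℓ : 0 < ℓ)
    (hv : v = ℓ • wordVector k) : IsLongSaddleConnectionVector v w ↔ w = wordVector k := by
  have hlen : 0 < len (wordVector k) := by
    have := (wordVector_mem_quadrant k).1
    exact Real.sqrt_pos.2 (by positivity)
  have hsaddle : IsSaddleConnectionVector (wordVector k) := by
    rw [← one_smul ℝ (wordVector k), isSaddleConnectionVector_smul_wordVector, one_smul]
    exact isSaddleConnectionVector_one_zero
  have hdir : SameDirection v (wordVector k) :=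
    ⟨ℓ⁻¹, inv_pos.2 hℓ, by rw [hv, inv_smul_smul₀ hℓ.ne']⟩
  have hle : ∀ w', IsSaddleConnectionVector w' → SameDirection v w' →
      ∃ c : ℝ, 0 < c ∧ c ≤ 1 ∧ w' = c • wordVector k := by
    rintro w' hw' ⟨c, hc, rfl⟩
    rw [hv, smul_smul] at hw' ⊢
    exact ⟨c * ℓ, mul_pos hc hℓ, horizontal_saddle_le (mul_pos hc hℓ)
      ((isSaddleConnectionVector_smul_wordVector _ k).1 hw'), rfl⟩
  constructor
  · rintro ⟨hw, hvw, hmax⟩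
    obtain ⟨c, hc, hc1, rfl⟩ := hle w hw hvw
    have h := hmax _ hsaddle hdir
    rw [len_smul hc.le] at h
    rw [le_antisymm hc1 (by nlinarith), one_smul]
  · rintro rfl
    refine ⟨hsaddle, hdir, fun w' hw' hvw' => ?_⟩
    obtain ⟨c, hc, hc1, rfl⟩ := hle w' hw' hvw'
    rw [len_smul hc.le]
    nlinarith

/-! ### Itineraries, uniqueness of the word, integrality -/

theorem sector_unique {v : Vec} {i j : Fin 4} (hi : v ∈ sector i) (hj : v ∈ sector j) :
    i = j := by
  have h1 := Real.one_lt_goldenRatio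
  rw [mem_sector_iff] at hi hj
  generalize φ = g at *
  fin_cases i <;> fin_cases j <;> first
    | rfl
    | (exfalso; simp at hi hj; nlinarith [hi.1, hi.2, hj.1, hj.2])

theorem IsItinerary.unique {v : Vec} {a b : ℕ → Fin 4} (ha : IsItinerary v a)
    (hb : IsItinerary v b) : a = b := by
  obtain ⟨u, hu0, hu⟩ := ha
  obtain ⟨w, hw0, hw⟩ := hb
  have huw : ∀ i, u i = w i := fun i => by
    induction i with
    | zero => rw [hu0, hw0]
    | succ i ih =>
      rw [(hu i).2, (hw i).2, sector_unique (hu i).1 (ih ▸ (hw i).1), ih]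
  exact funext fun i => sector_unique (hu i).1 (huw i ▸ (hw i).1)

/-- The default letter 0 is right for the exhausted word because σ₀ [1, 0] = [1, 0]; hence the tail
of zeros in the itinerary. -/
theorem sector_step (l : List (Fin 4)) {ℓ : ℝ} (hℓ : 0 < ℓ) :
    ℓ • wordVector l ∈ sector (l.getD 0 0) ∧
      ℓ • wordVector (l.drop 1) = (sigma (l.getD 0 0))⁻¹.mulVec (ℓ • wordVector l) := by
  have hmem : ∀ k, ℓ • wordVector k ∈ quadrant := fun k => by
    obtain ⟨h0, h1⟩ := wordVector_mem_quadrant k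
    exact ⟨mul_pos hℓ h0, mul_nonneg hℓ.le h1⟩
  have h : ℓ • wordVector l = (sigma (l.getD 0 0)).mulVec (ℓ • wordVector (l.drop 1)) := by
    cases l with
    | nil =>
      rw [List.drop_nil, List.getD_nil, wordVector_nil, Matrix.mulVec_smul]
      congr 1
      exact vec_ext (by simp [sigma]) (by simp [sigma])
    | cons i l =>
      rw [wordVector_cons, ← Matrix.mulVec_smul]
      rfl
  exact ⟨⟨_, hmem _, h.symm⟩, by rw [h, sigma_inv_mulVec_sigma]⟩

theorem isItinerary_word {v : Vec} {k : List (Fin 4)} {ℓ : ℝ} (hℓ : 0 < ℓ)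
    (hv : v = ℓ • wordVector k) : IsItinerary v fun i => k.getD i 0 := by
  refine ⟨fun i => ℓ • wordVector (k.drop i), hv.symm, fun i => ?_⟩
  have h := sector_step (k.drop i) hℓ
  have e : (k.drop i).getD 0 0 = k.getD i 0 := by simp [List.getD_eq_getElem?_getD]
  rwa [List.drop_drop, e] at h

theorem IsTreeWord.eq_nil {l : List (Fin 4)} (hl : IsTreeWord l) (h : ∀ i, l.getD i 0 = 0) :
    l = [] := by
  by_contra hne
  refine hl ?_
  rw [List.getLast?_eq_getElem?, ← h (l.length - 1), List.getD_eq_getElem?_getD]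
  have : l.length - 1 < l.length := Nat.sub_lt (List.length_pos_iff.2 hne) one_pos
  simp [List.getElem?_eq_getElem this]

theorem IsTreeWord.of_cons {i : Fin 4} {l : List (Fin 4)} (h : IsTreeWord (i :: l)) :
    IsTreeWord l := by
  unfold IsTreeWord at *
  cases l with
  | nil => simp
  | cons j l => rwa [List.getLast?_cons_cons] at h

theorem IsTreeWord.ext {k l : List (Fin 4)} (hk : IsTreeWord k) (hl : IsTreeWord l)
    (h : ∀ i, k.getD i 0 = l.getD i 0) : k = l := by
  induction k generalizing l with
  | nil => exact (hl.eq_nil fun i => by rw [← h i, List.getD_nil]).symm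
  | cons i k ih =>
    cases l with
    | nil => exact hk.eq_nil fun i => by rw [h i, List.getD_nil]
    | cons j l =>
      have hij : i = j := h 0
      rw [hij, ih hk.of_cons hl.of_cons fun n => h (n + 1)]

theorem wordVector_form (k : List (Fin 4)) :
    ∃ a b c d : ℕ, wordVector k = ![(a : ℝ) + b * φ, (c : ℝ) + d * φ] := by
  have h2 := goldenRatio_mul_self
  induction k with
  | nil => exact ⟨1, 0, 0, 0, by rw [wordVector_nil]; exact vec_ext (by simp) (by simp)⟩
  | cons i k ih =>
    obtain ⟨a, b, c, d, e⟩ := ih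
    rw [wordVector_cons, e]
    fin_cases i
    · exact ⟨a + d, b + c + d, c, d, vec_ext (by simp [sigma]; linear_combination d * h2)
        (by simp [sigma])⟩
    · exact ⟨b + d, a + c + b + d, a + d, b + c + d,
        vec_ext (by simp [sigma]; linear_combination (b + d) * h2)
          (by simp [sigma]; linear_combination d * h2)⟩
    · exact ⟨c + b, d + a + b, b + d, a + c + b + d,
        vec_ext (by simp [sigma]; linear_combination b * h2)
          (by simp [sigma]; linear_combination (b + d) * h2)⟩
    · exact ⟨a, b, c + b, d + a + b, vec_ext (by simp [sigma])
        (by simp [sigma]; linear_combination b * h2)⟩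

theorem IsPeriodicDirection.exists_isTreeWord {v : Vec} (hv : v ∈ quadrant)
    (h : IsPeriodicDirection v) :
    ∃ k, IsTreeWord k ∧ ∃ ℓ : ℝ, 0 < ℓ ∧ v = ℓ • wordVector k := by
  obtain ⟨-, γ, ⟨T, hT, hper⟩, hγ⟩ := h
  rcases hv.2.eq_or_lt with h1 | h1
  -- A horizontal v needs no descent: it is a multiple of the vector of the empty word.
  · refine ⟨[], by simp [IsTreeWord], v 0, hv.1, ?_⟩
    rw [wordVector_nil]
    exact vec_ext (by simp) (by simp [← h1])
  · have hp : HasPeriod v T := ⟨γ, hper, hγ⟩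
    obtain ⟨a, b, c, d, e⟩ := hp.exists_holonomy hT hv.1 h1
    exact GoldenL.exists_isTreeWord T hT _ v a b c d hv h1 hp e rfl

end GoldenL

end

theorem mainTheorem2 (v : GoldenL.Vec) (hv : v ∈ GoldenL.quadrant)
    (hper : GoldenL.IsPeriodicDirection v) :
    ∃ k : List (Fin 4),
      -- `k` is a tree word with `v = ℓ σ_{k₀} ⋯ σ_{kₙ} [1, 0]`
      GoldenL.IsTreeWord k ∧
      (∃ ℓ : ℝ, 0 < ℓ ∧ v = ℓ • GoldenL.wordVector k) ∧
      -- and it is the only one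
      (∀ k' : List (Fin 4), GoldenL.IsTreeWord k' →
        (∃ ℓ : ℝ, 0 < ℓ ∧ v = ℓ • GoldenL.wordVector k') → k' = k) ∧
      -- the algorithm applied to `v` produces exactly `k` followed by zeros
      (∀ a : ℕ → Fin 4, GoldenL.IsItinerary v a ↔ a = fun i => k.getD i 0) ∧
      -- the long saddle connection vector in the direction `v`
      (∀ w : GoldenL.Vec,
        GoldenL.IsLongSaddleConnectionVector v w ↔ w = GoldenL.wordVector k) ∧
      -- its form
      (∃ a b c d : ℕ, GoldenL.wordVector k =
        ![(a : ℝ) + b * Real.goldenRatio, (c : ℝ) + d * Real.goldenRatio]) := by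
  obtain ⟨k, hk, ℓ, hℓ, hvk⟩ := hper.exists_isTreeWord hv
  have hit := GoldenL.isItinerary_word hℓ hvk
  refine ⟨k, hk, ⟨ℓ, hℓ, hvk⟩, ?_, fun a => ⟨fun ha => ha.unique hit, fun ha => ha ▸ hit⟩,
    fun w => GoldenL.isLongSaddleConnectionVector_iff hℓ hvk, GoldenL.wordVector_form k⟩
  rintro k' hk' ⟨ℓ', hℓ', hvk'⟩
  exact hk'.ext hk fun i => congrFun ((GoldenL.isItinerary_word hℓ' hvk').unique hit) i
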